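/- Let $\gamma,q,c$ be real numbers, and let $\mu$ be the law of a real-valued process $X_1,X_2,\dots$ that is stationary (blocks of equal length that differ by a time shift have the same law) and satisfies $$\mathsf E[X_1^2]\le\gamma,\qquad P(X_1=0)-2c\,P(X_1=0,\,X_2\neq 0)\ge q .$$ Let $Y_i=X_i+N_i$ for $i\ge 1$, where $N_1,N_2,\dots$ are independent standard Gaussian random variables, and the process $(N_i)$ is independent of $(X_i)$. Write $X^n=(X_1,\dots,X_n)$ and $Y^n=(Y_1,\dots,Y_n)$. Let $I(\cdot\,;\cdot)$ denote mutual information and $h(\cdot)$ differential entropy, and let $(X,Y)$ denote a pair with the law of $(X_1,Y_1)$. Then $I(X^n;Y^n)$, $I(X;Y)$, $h(Y^n)$ and $h(Y)$ are well defined and finite for every $n\ge1$, the differential entropy rate $h(\mathscr Y)=\lim_{n\to\infty}\frac1n h(Y^n)$ of the output process exists and is finite, and the limit of the input–output mutual information per symbol exists and equals $$\lim_{n\to\infty}\frac1n I(X^n;Y^n)=I(X;Y)-h(Y)+h(\mathscr Y).$$ -/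

import Mathlib

namespace AWGN

open MeasureTheory ProbabilityTheory Filter

/-- A law on real sequences is stationary: any two blocks of the same length that differ by a
time shift have the same law. (Sequences are indexed from `0`; the symbol at time `1` is `x 0`.) -/
def IsStationary (μ : Measure (ℕ → ℝ)) : Prop :=
  ∀ s k n : ℕ, μ.map (fun x (i : Fin n) => x (s + i)) = μ.map (fun x (i : Fin n) => x (s + k + i))

/-- The stationary input laws satisfying the duty cycle constraint `(q, c)` and the power
constraint `γ`. -/
def inputLaws (γ q c : ℝ) : Set (Measure (ℕ → ℝ)) :=
  {μ | IsProbabilityMeasure μ ∧ IsStationary μ ∧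
    (Integrable (fun x : ℕ → ℝ => x 0 ^ 2) μ ∧ ∫ x, x 0 ^ 2 ∂μ ≤ γ) ∧
    q ≤ μ.real {x | x 0 = 0} - 2 * c * μ.real {x | x 0 = 0 ∧ x 1 ≠ 0}}

/-- The additive white Gaussian noise channel: `Y i = X i + N i`, with independent standard
Gaussian noise variables `N i`, the noise process being independent of the input process `X`. -/
structure IsAWGNChannel {Ω : Type*} [MeasurableSpace Ω] (P : Measure Ω)
    (X N Y : ℕ → Ω → ℝ) : Prop where
  measurable_input : ∀ i, Measurable (X i)
  measurable_noise : ∀ i, Measurable (N i)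
  noise_law : ∀ i, P.map (N i) = gaussianReal 0 1
  noise_indep : iIndepFun N P
  input_indep_noise : IndepFun (fun ω i => X i ω) (fun ω i => N i ω) P
  output_eq : ∀ i ω, Y i ω = X i ω + N i ω

/-- The random vector of the first `n` symbols of a process. -/
def block {Ω : Type*} (Z : ℕ → Ω → ℝ) (n : ℕ) (ω : Ω) : Fin n → ℝ := fun i => Z i ω

/-- Mutual information (in nats, possibly `∞`): the Kullback-Leibler divergence of the joint law
from the product of the marginal laws. -/
noncomputable def mutualInfo {Ω E F : Type*} [MeasurableSpace Ω] [MeasurableSpace E]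
    [MeasurableSpace F] (P : Measure Ω) (U : Ω → E) (V : Ω → F) : ENNReal :=
  InformationTheory.klDiv (P.map (fun ω => (U ω, V ω))) ((P.map U).prod (P.map V))

/-- The law `ν` has a density `p` with respect to Lebesgue measure, and `p log p` is integrable,
so that its differential entropy is well defined and finite. -/
def HasFiniteDiffEntropy {E : Type*} [MeasureSpace E] (ν : Measure E) : Prop :=
  ν ≪ volume ∧ Integrable (fun y => Real.negMulLog (ν.rnDeriv volume y).toReal) volume

/-- Differential entropy `-∫ p log p` (in nats) of a law `ν` with Lebesgue density `p`; it is
meaningful when `HasFiniteDiffEntropy ν`. -/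
noncomputable def diffEntropy {E : Type*} [MeasureSpace E] (ν : Measure E) : ℝ :=
  ∫ y, Real.negMulLog (ν.rnDeriv volume y).toReal

/-- Differential entropy rate `lim h(Y_1, …, Y_n) / n` of a process; it is meaningful when the
limit exists. -/
noncomputable def diffEntropyRate {Ω : Type*} [MeasurableSpace Ω] (P : Measure Ω)
    (Y : ℕ → Ω → ℝ) : ℝ :=
  limUnder atTop (fun n : ℕ => diffEntropy (P.map (block Y n)) / (n : ℝ))

end AWGN

/-! Since `Y = X + N` with independent noise, the joint law of input and output has density `φ (y -
x) / f y` against the product of its marginals, where `f` is the output density. Taking logarithms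
and integrating gives `I = h(output) - h(noise)`. The noise is i.i.d., so its entropy over `n`
symbols is `-n * gaussianLogMean`; hence `I(X^n;Y^n) = n * gaussianLogMean + h(Y^n)`, and in the
scalar case `I(X;Y) - h(Y) = gaussianLogMean`. Dividing by `n` reduces the claim to the existence of
the entropy rate.

The rate exists by Fekete's lemma. Gibbs' inequality, applied to the product of the densities of two
consecutive blocks, gives subadditivity once stationarity identifies the second block with an
initial one. Nonnegativity of mutual information gives `h(Y^n) ≥ -n * gaussianLogMean`, so the
quotients are bounded below.

All integrals are finite because the output density is bounded above by the bound on `φ`, while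
Jensen bounds its logarithm below by an averaged quadratic, integrable by finite power. -/

namespace AWGN

open MeasureTheory ProbabilityTheory Filter

/-! ### Additive noise with a general bounded positive density -/

section AdditiveNoise

/-- The density of `U + Z` when `U` has law `ρ` and the independent noise `Z` has density `φ`. -/
noncomputable def outputDensity {E : Type*} [MeasurableSpace E] [Sub E] (φ : E → ℝ)
    (ρ : Measure E) (y : E) : ℝ :=
  ∫ x, φ (y - x) ∂ρ

section Density

variable {E : Type*} [MeasurableSpace E] [AddCommGroup E] [MeasurableSub₂ E]
  {φ : E → ℝ} {ρ : Measure E} [IsProbabilityMeasure ρ] {C : ℝ}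

lemma integrable_noiseDensity_sub (hφ : Measurable φ) (hpos : ∀ z, 0 < φ z) (hC : ∀ z, φ z ≤ C)
    (y : E) : Integrable (fun x => φ (y - x)) ρ :=
  Integrable.of_bound (hφ.comp (by fun_prop)).aestronglyMeasurable C
    (ae_of_all _ fun x => by rw [Real.norm_eq_abs, abs_of_pos (hpos _)]; exact hC _)

lemma measurable_outputDensity (hφ : Measurable φ) : Measurable (outputDensity φ ρ) := by
  have : StronglyMeasurable (fun p : E × E => φ (p.1 - p.2)) :=
    (hφ.comp (by fun_prop)).stronglyMeasurable
  exact this.integral_prod_right.measurable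

lemma outputDensity_pos (hφ : Measurable φ) (hpos : ∀ z, 0 < φ z) (hC : ∀ z, φ z ≤ C) (y : E) :
    0 < outputDensity φ ρ y := by
  unfold outputDensity
  rw [integral_pos_iff_support_of_nonneg (fun x => (hpos _).le)
    (integrable_noiseDensity_sub hφ hpos hC y)]
  have : Function.support (fun x => φ (y - x)) = Set.univ := by
    ext x; simpa using (hpos (y - x)).ne'
  rw [this]; simp

lemma outputDensity_le (hφ : Measurable φ) (hpos : ∀ z, 0 < φ z) (hC : ∀ z, φ z ≤ C) (y : E) :
    outputDensity φ ρ y ≤ C := by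
  have := integral_mono (integrable_noiseDensity_sub (ρ := ρ) hφ hpos hC y) (integrable_const C)
    (fun x => hC (y - x))
  simpa [outputDensity] using this

/-- Jensen's inequality for the density of the output. -/
lemma integral_log_le_log_outputDensity (hφ : Measurable φ) (hpos : ∀ z, 0 < φ z)
    (hC : ∀ z, φ z ≤ C) {y : E} (hy : Integrable (fun x => Real.log (φ (y - x))) ρ) :
    ∫ x, Real.log (φ (y - x)) ∂ρ ≤ Real.log (outputDensity φ ρ y) := by
  rw [Real.le_log_iff_exp_le (outputDensity_pos hφ hpos hC y)]
  have := convexOn_exp.map_integral_le (μ := ρ) (f := fun x => Real.log (φ (y - x)))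
    Real.continuous_exp.continuousOn isClosed_univ (by simp) hy
    ((integrable_noiseDensity_sub (ρ := ρ) hφ hpos hC y).congr
      (ae_of_all _ fun x => (Real.exp_log (hpos (y - x))).symm))
  simpa [outputDensity, Real.exp_log (hpos _)] using this

/-- The logarithm lies between the Jensen lower bound and `log C`. In `hint` the variables `y` and
`x` are integrated independently, not under the joint input-output law. -/
lemma integrable_log_outputDensity (hφ : Measurable φ) (hpos : ∀ z, 0 < φ z)
    (hC : ∀ z, φ z ≤ C) {ν : Measure E} [IsProbabilityMeasure ν]
    (hint : Integrable (fun p : E × E => Real.log (φ (p.1 - p.2))) (ν.prod ρ)) :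
    Integrable (fun y => Real.log (outputDensity φ ρ y)) ν := by
  refine Integrable.mono' (hint.integral_prod_left.norm.add (integrable_const |Real.log C|))
    (measurable_outputDensity hφ).log.aestronglyMeasurable ?_
  filter_upwards [hint.prod_right_ae] with y hy
  have h1 := integral_log_le_log_outputDensity hφ hpos hC hy
  have h2 : Real.log (outputDensity φ ρ y) ≤ Real.log C :=
    Real.log_le_log (outputDensity_pos hφ hpos hC y) (outputDensity_le hφ hpos hC y)
  have h3 := neg_abs_le (∫ x, Real.log (φ (y - x)) ∂ρ)
  have h4 := le_abs_self (Real.log C)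
  have h5 := abs_nonneg (Real.log C)
  have h6 := abs_nonneg (∫ x, Real.log (φ (y - x)) ∂ρ)
  simp only [Real.norm_eq_abs, Pi.add_apply, abs_le]
  constructor <;> linarith

end Density

/-! ### Entropy of laws with a positive density, and Gibbs' inequality -/

section Entropy

variable {E : Type*} [MeasureSpace E] {ν : Measure E}
  {f : E → ℝ}

lemma rnDeriv_toReal_ae_eq [SigmaFinite (volume : Measure E)] (hf : Measurable f)
    (hpos : ∀ y, 0 < f y)
    (hν : ν = volume.withDensity fun y => ENNReal.ofReal (f y)) :
    (fun y => (ν.rnDeriv volume y).toReal) =ᵐ[volume] f := by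
  subst hν
  filter_upwards [Measure.rnDeriv_withDensity (volume : Measure E) hf.ennreal_ofReal] with y hy
  rw [hy, ENNReal.toReal_ofReal (hpos y).le]

lemma hasFiniteDiffEntropy_of_density [SigmaFinite (volume : Measure E)] (hf : Measurable f)
    (hpos : ∀ y, 0 < f y)
    (hν : ν = volume.withDensity fun y => ENNReal.ofReal (f y))
    (hint : Integrable (fun y => Real.log (f y)) ν) : HasFiniteDiffEntropy ν := by
  refine ⟨hν ▸ withDensity_absolutelyContinuous _ _, ?_⟩
  rw [hν, integrable_withDensity_iff_integrable_smul₀' hf.ennreal_ofReal.aemeasurable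
    (by simp)] at hint
  refine hint.neg.congr ?_
  filter_upwards [rnDeriv_toReal_ae_eq hf hpos hν] with y hy
  simp [hy, Real.negMulLog, ENNReal.toReal_ofReal (hpos y).le]

lemma diffEntropy_eq_of_density [SigmaFinite (volume : Measure E)] (hf : Measurable f)
    (hpos : ∀ y, 0 < f y)
    (hν : ν = volume.withDensity fun y => ENNReal.ofReal (f y)) :
    diffEntropy ν = -∫ y, Real.log (f y) ∂ν := by
  rw [diffEntropy, ← integral_neg]
  nth_rw 2 [hν]
  rw [integral_withDensity_eq_integral_toReal_smul hf.ennreal_ofReal (by simp)]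
  refine integral_congr_ae ?_
  filter_upwards [rnDeriv_toReal_ae_eq hf hpos hν] with y hy
  simp [hy, Real.negMulLog, ENNReal.toReal_ofReal (hpos y).le]

/-- Gibbs' inequality. -/
lemma integral_log_density_le [IsProbabilityMeasure ν] (hf : Measurable f) (hpos : ∀ y, 0 < f y)
    (hν : ν = volume.withDensity fun y => ENNReal.ofReal (f y))
    (hint : Integrable (fun y => Real.log (f y)) ν) {g : E → ℝ} (hg : Measurable g)
    (hgpos : ∀ y, 0 < g y) (hgle : ∫⁻ y, ENNReal.ofReal (g y) ≤ 1)
    (hgint : Integrable (fun y => Real.log (g y)) ν) :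
    ∫ y, Real.log (g y) ∂ν ≤ ∫ y, Real.log (f y) ∂ν := by
  have hle : ∫⁻ y, ENNReal.ofReal (g y / f y) ∂ν ≤ 1 := by
    rw [hν, lintegral_withDensity_eq_lintegral_mul _ hf.ennreal_ofReal (by fun_prop)]
    refine (lintegral_congr fun y => ?_).trans_le hgle
    rw [Pi.mul_apply, ← ENNReal.ofReal_mul (hpos y).le, mul_div_cancel₀ _ (hpos y).ne']
  have hnn : ∀ y, 0 ≤ g y / f y := fun y => (div_pos (hgpos y) (hpos y)).le
  have hrm : Measurable fun y => g y / f y := hg.div hf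
  have hri : Integrable (fun y => g y / f y) ν := by
    rw [← lintegral_ofReal_ne_top_iff_integrable hrm.aestronglyMeasurable
      (ae_of_all _ hnn)]
    exact ne_top_of_le_ne_top ENNReal.one_ne_top hle
  have hr1 : ∫ y, g y / f y ∂ν ≤ 1 := by
    rw [integral_eq_lintegral_of_nonneg_ae (ae_of_all _ hnn)
      hrm.aestronglyMeasurable]
    exact ENNReal.toReal_le_of_le_ofReal zero_le_one (by simpa using hle)
  -- Integrate `log t ≤ t - 1` at `t = g / f`; the right side has integral at most `0`.
  have := integral_mono (hgint.sub hint) (hri.sub (integrable_const 1)) fun y => by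
    have := Real.log_le_sub_one_of_pos (div_pos (hgpos y) (hpos y))
    rwa [Real.log_div (hgpos y).ne' (hpos y).ne'] at this
  simp only [Pi.sub_apply] at this
  rw [integral_sub hgint hint, integral_sub hri (integrable_const 1)] at this
  simp at this
  linarith

end Entropy

/-! ### Joint law, output law and mutual information of an additive channel -/

section Channel

variable {Ω E : Type*} [MeasurableSpace Ω] {P : Measure Ω} [IsProbabilityMeasure P]
  [MeasureSpace E] [SigmaFinite (volume : Measure E)] [AddCommGroup E] [MeasurableAdd₂ E]
  [MeasurableSub₂ E] [(volume : Measure E).IsAddLeftInvariant]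
  {φ : E → ℝ} {C : ℝ} {U Z V : Ω → E}

/-- The shear `(x, z) ↦ (x, x + z)` preserves the product of the input law with Lebesgue measure, so
it carries the density `φ z` to `φ (y - x)`. -/
lemma map_input_output (hφ : Measurable φ) (hU : Measurable U) (hZ : Measurable Z)
    (hUZ : IndepFun U Z P) (hlaw : P.map Z = volume.withDensity fun z => ENNReal.ofReal (φ z))
    (hV : ∀ ω, V ω = U ω + Z ω) :
    P.map (fun ω => (U ω, V ω)) =
      ((P.map U).prod volume).withDensity fun p => ENNReal.ofReal (φ (p.2 - p.1)) := by
  have : IsProbabilityMeasure (P.map U) := Measure.isProbabilityMeasure_map hU.aemeasurable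
  have h1 : P.map (fun ω => (U ω, Z ω)) =
      ((P.map U).prod volume).withDensity fun p => ENNReal.ofReal (φ p.2) := by
    rw [hUZ.map_prod_eq_prod_map_map hU.aemeasurable hZ.aemeasurable, hlaw,
      prod_withDensity_right hφ.ennreal_ofReal]
  have h2 : (fun ω => (U ω, V ω)) = (fun p : E × E => (p.1, p.1 + p.2)) ∘ fun ω => (U ω, Z ω) := by
    ext ω <;> simp [hV]
  have h3 := measurePreserving_prod_add (P.map U) (volume : Measure E)
  rw [h2, ← Measure.map_map (by fun_prop) (by fun_prop), h1]
  refine Measure.ext_of_lintegral _ fun f hf => ?_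
  rw [lintegral_map hf (by fun_prop), lintegral_withDensity_eq_lintegral_mul _ (by fun_prop)
    (by fun_prop), lintegral_withDensity_eq_lintegral_mul _ (by fun_prop) hf,
    ← h3.lintegral_comp
      (f := (fun p : E × E => ENNReal.ofReal (φ (p.2 - p.1))) * f) (by fun_prop)]
  simp

lemma map_output (hφ : Measurable φ) (hpos : ∀ z, 0 < φ z) (hC : ∀ z, φ z ≤ C)
    (hU : Measurable U) (hZ : Measurable Z)
    (hUZ : IndepFun U Z P) (hlaw : P.map Z = volume.withDensity fun z => ENNReal.ofReal (φ z))
    (hV : ∀ ω, V ω = U ω + Z ω) :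
    P.map V = volume.withDensity fun y => ENNReal.ofReal (outputDensity φ (P.map U) y) := by
  have : IsProbabilityMeasure (P.map U) := Measure.isProbabilityMeasure_map hU.aemeasurable
  have hVm : Measurable V := by rw [funext hV]; fun_prop
  have h2 : P.map V = (P.map fun ω => (U ω, V ω)).map Prod.snd := by
    rw [Measure.map_map measurable_snd (by fun_prop)]; rfl
  rw [h2, map_input_output hφ hU hZ hUZ hlaw hV]
  refine Measure.ext_of_lintegral _ fun f hf => ?_
  have hm := (measurable_outputDensity (ρ := P.map U) hφ).ennreal_ofReal
  rw [lintegral_map hf (by fun_prop), lintegral_withDensity_eq_lintegral_mul _ (by fun_prop)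
    (by fun_prop), lintegral_withDensity_eq_lintegral_mul _ hm hf,
    lintegral_prod_symm _ (by fun_prop)]
  refine lintegral_congr fun y => ?_
  simp only [Pi.mul_apply]
  rw [lintegral_mul_const _ (by fun_prop), outputDensity,
    ofReal_integral_eq_lintegral_ofReal (integrable_noiseDensity_sub hφ hpos hC y)
      (ae_of_all _ fun x => (hpos _).le)]

lemma mutualInfo_additiveNoise (hφ : Measurable φ) (hpos : ∀ z, 0 < φ z) (hC : ∀ z, φ z ≤ C)
    (hU : Measurable U) (hZ : Measurable Z)
    (hUZ : IndepFun U Z P) (hlaw : P.map Z = volume.withDensity fun z => ENNReal.ofReal (φ z))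
    (hV : ∀ ω, V ω = U ω + Z ω) (hφint : Integrable (fun ω => Real.log (φ (Z ω))) P)
    (hint : Integrable (fun y => Real.log (outputDensity φ (P.map U) y)) (P.map V)) :
    mutualInfo P U V ≠ ⊤ ∧
      (mutualInfo P U V).toReal = ∫ ω, Real.log (φ (Z ω)) ∂P + diffEntropy (P.map V) := by
  have : IsProbabilityMeasure (P.map U) := Measure.isProbabilityMeasure_map hU.aemeasurable
  have hVm : Measurable V := by rw [funext hV]; fun_prop
  have : IsProbabilityMeasure (P.map V) := Measure.isProbabilityMeasure_map hVm.aemeasurable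
  have hJp : IsProbabilityMeasure (P.map (fun ω => (U ω, V ω))) :=
    Measure.isProbabilityMeasure_map (by fun_prop)
  set f := outputDensity φ (P.map U) with hf
  have hfm : Measurable f := measurable_outputDensity hφ
  have hfpos : ∀ y, 0 < f y := outputDensity_pos hφ hpos hC
  have hVlaw : P.map V = volume.withDensity fun y => ENNReal.ofReal (f y) :=
    map_output hφ hpos hC hU hZ hUZ hlaw hV
  have hJ := map_input_output hφ hU hZ hUZ hlaw hV
  set r : E × E → ENNReal := fun p => ENNReal.ofReal (φ (p.2 - p.1) / f p.2) with hr
  have hrm : Measurable r := by fun_prop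
  have hJr : P.map (fun ω => (U ω, V ω)) = ((P.map U).prod (P.map V)).withDensity r := by
    rw [hJ, hVlaw, prod_withDensity_right (by fun_prop), ← withDensity_mul _ (by fun_prop) hrm]
    congr 1
    ext p
    simp only [Pi.mul_apply, hr]
    rw [← ENNReal.ofReal_mul (hfpos _).le, mul_div_cancel₀ _ (hfpos _).ne']
  have hac : P.map (fun ω => (U ω, V ω)) ≪ (P.map U).prod (P.map V) :=
    hJr ▸ withDensity_absolutelyContinuous _ _
  have hllr : llr (P.map (fun ω => (U ω, V ω))) ((P.map U).prod (P.map V))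
      =ᵐ[P.map (fun ω => (U ω, V ω))]
      fun p => Real.log (φ (p.2 - p.1)) - Real.log (f p.2) := by
    refine hac.ae_le ?_
    have := Measure.rnDeriv_withDensity ((P.map U).prod (P.map V)) hrm
    rw [← hJr] at this
    filter_upwards [this] with p hp
    rw [llr, hp, hr, ENNReal.toReal_ofReal (div_pos (hpos _) (hfpos _)).le,
      Real.log_div (hpos _).ne' (hfpos _).ne']
  -- Along the channel `V - U = Z`, so the log-likelihood ratio splits into a noise term and an
  -- output term, each integrable on its own.
  have hcomp : (fun p : E × E => Real.log (φ (p.2 - p.1)) - Real.log (f p.2)) ∘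
      (fun ω => (U ω, V ω)) = fun ω => Real.log (φ (Z ω)) - Real.log (f (V ω)) := by
    ext ω; simp [hV]
  have hfV : Integrable (fun ω => Real.log (f (V ω))) P := hint.comp_measurable hVm
  have hm : Measurable fun p : E × E => Real.log (φ (p.2 - p.1)) - Real.log (f p.2) := by fun_prop
  have hI : Integrable (fun p : E × E => Real.log (φ (p.2 - p.1)) - Real.log (f p.2))
      (P.map (fun ω => (U ω, V ω))) := by
    rw [integrable_map_measure hm.aestronglyMeasurable (by fun_prop), hcomp]
    exact hφint.sub hfV
  refine ⟨InformationTheory.klDiv_ne_top hac ((integrable_congr hllr).2 hI), ?_⟩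
  rw [mutualInfo, InformationTheory.toReal_klDiv_of_measure_eq hac (by simp),
    integral_congr_ae hllr, integral_map (by fun_prop) hm.aestronglyMeasurable,
    diffEntropy_eq_of_density hfm hfpos hVlaw,
    integral_map hVm.aemeasurable hfm.log.aestronglyMeasurable, ← sub_eq_add_neg,
    ← integral_sub hφint hfV]
  exact integral_congr_ae (ae_of_all _ fun ω => congrFun hcomp ω)

end Channel

end AdditiveNoise


/-! ### Standard Gaussian densities -/

section GaussianNoise

lemma gaussianPDFReal_zero_one_pos (x : ℝ) : 0 < gaussianPDFReal 0 1 x :=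
  gaussianPDFReal_pos 0 1 x one_ne_zero

/-- The bound `1` is crude, but it is stable under products and so serves every block length. -/
lemma gaussianPDFReal_zero_one_le_one (x : ℝ) : gaussianPDFReal 0 1 x ≤ 1 := by
  rw [gaussianPDFReal_def]
  have h1 : (√(2 * Real.pi * ((1 : NNReal) : ℝ)))⁻¹ ≤ 1 := by
    refine inv_le_one_of_one_le₀ (Real.one_le_sqrt.2 ?_)
    have := Real.pi_gt_three
    push_cast
    linarith
  have h2 : Real.exp (-(x - 0) ^ 2 / (2 * ((1 : NNReal) : ℝ))) ≤ 1 := by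
    rw [Real.exp_le_one_iff]
    exact div_nonpos_of_nonpos_of_nonneg (neg_nonpos.2 (sq_nonneg _)) (by positivity)
  exact mul_le_one₀ h1 (Real.exp_pos _).le h2

lemma log_gaussianPDFReal_zero_one (x : ℝ) :
    Real.log (gaussianPDFReal 0 1 x) = Real.log (√(2 * Real.pi))⁻¹ - x ^ 2 / 2 := by
  have : (√(2 * Real.pi))⁻¹ ≠ 0 := by positivity
  rw [gaussianPDFReal_def]
  simp only [NNReal.coe_one, mul_one, sub_zero]
  rw [Real.log_mul this (Real.exp_pos _).ne', Real.log_exp]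
  ring

lemma integrable_log_gaussianPDFReal_comp {α : Type*} [MeasurableSpace α] {ν : Measure α}
    [IsFiniteMeasure ν] {W : α → ℝ} (hW : MemLp W 2 ν) :
    Integrable (fun a => Real.log (gaussianPDFReal 0 1 (W a))) ν := by
  simp only [log_gaussianPDFReal_zero_one]
  exact (integrable_const _).sub (hW.integrable_sq.div_const 2)

/-- The density of a standard Gaussian vector. -/
noncomputable def stdGaussianDensity {ι : Type*} [Fintype ι] (z : ι → ℝ) : ℝ :=
  ∏ i, gaussianPDFReal 0 1 (z i)

variable {ι : Type*} [Fintype ι]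

lemma measurable_stdGaussianDensity : Measurable (stdGaussianDensity (ι := ι)) :=
  Finset.measurable_prod _ fun i _ =>
    (measurable_gaussianPDFReal 0 1).comp (measurable_pi_apply i)

lemma stdGaussianDensity_pos (z : ι → ℝ) : 0 < stdGaussianDensity z :=
  Finset.prod_pos fun _ _ => gaussianPDFReal_zero_one_pos _

lemma stdGaussianDensity_le_one (z : ι → ℝ) : stdGaussianDensity z ≤ 1 :=
  Finset.prod_le_one (fun _ _ => (gaussianPDFReal_zero_one_pos _).le)
    fun _ _ => gaussianPDFReal_zero_one_le_one _

lemma log_stdGaussianDensity (z : ι → ℝ) :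
    Real.log (stdGaussianDensity z) = ∑ i, Real.log (gaussianPDFReal 0 1 (z i)) :=
  Real.log_prod fun _ _ => (gaussianPDFReal_zero_one_pos _).ne'

lemma pi_gaussianReal_eq_withDensity :
    Measure.pi (fun _ : ι => gaussianReal 0 1) =
      volume.withDensity fun z => ENNReal.ofReal (stdGaussianDensity z) := by
  refine Measure.pi_eq fun s hs => ?_
  have hint : ∀ i, Integrable (gaussianPDFReal 0 1) (volume.restrict (s i)) := fun i =>
    (integrable_gaussianPDFReal 0 1).restrict
  rw [withDensity_apply _ (MeasurableSet.univ_pi hs), volume_pi, Measure.restrict_pi_pi]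
  unfold stdGaussianDensity
  rw [← ofReal_integral_eq_lintegral_ofReal (Integrable.fintype_prod hint)
      (ae_of_all _ fun z => (stdGaussianDensity_pos z).le),
    integral_fintype_prod_eq_prod (fun _ => gaussianPDFReal 0 1),
    ENNReal.ofReal_prod_of_nonneg fun i _ => integral_nonneg (gaussianPDFReal_nonneg 0 1)]
  exact Finset.prod_congr rfl fun i _ => (gaussianReal_apply_eq_integral 0 one_ne_zero _).symm

end GaussianNoise

/-! ### Splitting a block of `n + m` coordinates -/

section Split

variable {n m : ℕ}

lemma volume_preserving_split (n m : ℕ) :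
    MeasurePreserving (fun y : Fin (n + m) → ℝ =>
      ((fun i => y (Fin.castAdd m i) : Fin n → ℝ), (fun j => y (Fin.natAdd n j) : Fin m → ℝ))) := by
  have h := (volume_measurePreserving_sumPiEquivProdPi (fun _ : Fin n ⊕ Fin m => ℝ)).comp
    (volume_measurePreserving_piCongrLeft (fun _ : Fin n ⊕ Fin m => ℝ) finSumFinEquiv.symm)
  have happ (y : Fin (n + m) → ℝ) (i : Fin (n + m)) :=
    MeasurableEquiv.piCongrLeft_apply_apply (β := fun _ : Fin n ⊕ Fin m => ℝ)
      finSumFinEquiv.symm y i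
  refine (congrArg (fun f => MeasurePreserving f volume volume) ?_).mpr h
  ext y i
  · have := happ y (Fin.castAdd m i)
    rw [finSumFinEquiv_symm_apply_castAdd] at this
    exact this.symm
  · have := happ y (Fin.natAdd n i)
    rw [finSumFinEquiv_symm_apply_natAdd] at this
    exact this.symm

lemma lintegral_split_mul {f : (Fin n → ℝ) → ENNReal} {g : (Fin m → ℝ) → ENNReal}
    (hf : Measurable f) (hg : Measurable g) :
    ∫⁻ y : Fin (n + m) → ℝ, f (fun i => y (Fin.castAdd m i)) * g (fun j => y (Fin.natAdd n j)) =
      (∫⁻ y, f y) * ∫⁻ y, g y := by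
  rw [← lintegral_prod_mul hf.aemeasurable hg.aemeasurable]
  exact (volume_preserving_split n m).lintegral_comp
    (f := fun p : (Fin n → ℝ) × (Fin m → ℝ) => f p.1 * g p.2) (by fun_prop)

end Split

/-! ### The Gaussian channel on blocks, and the entropy rate -/

section Channel

variable {Ω : Type*} [MeasurableSpace Ω] {P : Measure Ω} {X N Y : ℕ → Ω → ℝ}

/-- The density of the first `n` outputs of the channel. -/
noncomputable def blockDensity (P : Measure Ω) (X : ℕ → Ω → ℝ) (n : ℕ) : (Fin n → ℝ) → ℝ :=
  outputDensity stdGaussianDensity (P.map (block X n))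

/-- The expected log-density of a standard Gaussian variable, the negative of its entropy. -/
noncomputable def gaussianLogMean : ℝ := ∫ x, Real.log (gaussianPDFReal 0 1 x) ∂gaussianReal 0 1

lemma measurable_block {Z : ℕ → Ω → ℝ} (hZ : ∀ i, Measurable (Z i)) (n : ℕ) :
    Measurable (block Z n) :=
  measurable_pi_lambda _ fun i => hZ i

namespace IsAWGNChannel

/-- Lets results on initial blocks apply to blocks starting at any time. -/
lemma shift (hch : IsAWGNChannel P X N Y) (s : ℕ) :
    IsAWGNChannel P (fun i => X (s + i)) (fun i => N (s + i)) (fun i => Y (s + i)) where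
  measurable_input _ := hch.measurable_input _
  measurable_noise _ := hch.measurable_noise _
  noise_law _ := hch.noise_law _
  noise_indep := hch.noise_indep.precomp (g := fun i => s + i) (add_right_injective s)
  input_indep_noise := hch.input_indep_noise.comp
    (φ := fun (x : ℕ → ℝ) i => x (s + i)) (ψ := fun (x : ℕ → ℝ) i => x (s + i))
    (by fun_prop) (by fun_prop)
  output_eq _ _ := hch.output_eq _ _

lemma measurable_output (hch : IsAWGNChannel P X N Y) (i : ℕ) : Measurable (Y i) := by
  rw [funext (hch.output_eq i)]
  exact (hch.measurable_input i).add (hch.measurable_noise i)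

lemma measurable_block_input (hch : IsAWGNChannel P X N Y) (n : ℕ) : Measurable (block X n) :=
  measurable_block hch.measurable_input n

lemma measurable_block_noise (hch : IsAWGNChannel P X N Y) (n : ℕ) : Measurable (block N n) :=
  measurable_block hch.measurable_noise n

lemma measurable_block_output (hch : IsAWGNChannel P X N Y) (n : ℕ) : Measurable (block Y n) :=
  measurable_block hch.measurable_output n

lemma block_output_eq (hch : IsAWGNChannel P X N Y) (n : ℕ) (ω : Ω) :
    block Y n ω = block X n ω + block N n ω :=
  funext fun i => hch.output_eq i ω

lemma indepFun_block (hch : IsAWGNChannel P X N Y) (n : ℕ) :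
    IndepFun (block X n) (block N n) P :=
  hch.input_indep_noise.comp
    (φ := fun (x : ℕ → ℝ) (i : Fin n) => x i) (ψ := fun (x : ℕ → ℝ) (i : Fin n) => x i)
    (by fun_prop) (by fun_prop)

lemma indepFun_zero (hch : IsAWGNChannel P X N Y) : IndepFun (X 0) (N 0) P :=
  hch.input_indep_noise.comp
    (φ := fun x : ℕ → ℝ => x 0) (ψ := fun x : ℕ → ℝ => x 0) (by fun_prop) (by fun_prop)

lemma memLp_noise (hch : IsAWGNChannel P X N Y) (i : ℕ) : MemLp (N i) 2 P := by
  have := memLp_id_gaussianReal (μ := 0) (v := 1) 2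
  rw [← hch.noise_law i, memLp_map_measure_iff (by fun_prop)
    (hch.measurable_noise i).aemeasurable] at this
  simpa using this

lemma memLp_output (hch : IsAWGNChannel P X N Y) {i : ℕ} (hX : MemLp (X i) 2 P) :
    MemLp (Y i) 2 P := by
  rw [funext (hch.output_eq i)]
  exact hX.add (hch.memLp_noise i)

lemma integral_log_noise (hch : IsAWGNChannel P X N Y) (i : ℕ) :
    ∫ ω, Real.log (gaussianPDFReal 0 1 (N i ω)) ∂P = gaussianLogMean := by
  rw [gaussianLogMean, ← hch.noise_law i, integral_map (hch.measurable_noise i).aemeasurable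
    (measurable_gaussianPDFReal 0 1).log.aestronglyMeasurable]

lemma map_noise_zero (hch : IsAWGNChannel P X N Y) :
    P.map (N 0) = volume.withDensity fun z => ENNReal.ofReal (gaussianPDFReal 0 1 z) := by
  rw [hch.noise_law 0, gaussianReal_of_var_ne_zero _ one_ne_zero]
  rfl

lemma map_block_noise (hch : IsAWGNChannel P X N Y) (n : ℕ) :
    P.map (block N n) = volume.withDensity fun z => ENNReal.ofReal (stdGaussianDensity z) := by
  have hind : iIndepFun (fun i : Fin n => N i) P := hch.noise_indep.precomp Fin.val_injective
  have := hind.map_fun_eq_pi_map fun i : Fin n => (hch.measurable_noise i).aemeasurable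
  simp only [hch.noise_law] at this
  rw [← pi_gaussianReal_eq_withDensity, ← this]
  rfl

lemma integrable_log_noise (hch : IsAWGNChannel P X N Y) [IsProbabilityMeasure P] (i : ℕ) :
    Integrable (fun ω => Real.log (gaussianPDFReal 0 1 (N i ω))) P :=
  integrable_log_gaussianPDFReal_comp (hch.memLp_noise i)

lemma integrable_log_block_noise (hch : IsAWGNChannel P X N Y) [IsProbabilityMeasure P] (n : ℕ) :
    Integrable (fun ω => Real.log (stdGaussianDensity (block N n ω))) P := by
  simp only [log_stdGaussianDensity]
  exact integrable_finsetSum _ fun i _ => hch.integrable_log_noise i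

lemma integral_log_block_noise (hch : IsAWGNChannel P X N Y) [IsProbabilityMeasure P] (n : ℕ) :
    ∫ ω, Real.log (stdGaussianDensity (block N n ω)) ∂P = n * gaussianLogMean := by
  simp only [log_stdGaussianDensity]
  rw [integral_finsetSum (f := fun (i : Fin n) ω => Real.log (gaussianPDFReal 0 1 (block N n ω i)))
    _ fun i _ => hch.integrable_log_noise i]
  have : ∀ i : Fin n, ∫ ω, Real.log (gaussianPDFReal 0 1 (block N n ω i)) ∂P = gaussianLogMean :=
    fun i => hch.integral_log_noise i
  simp [this]

variable [IsProbabilityMeasure P]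

lemma measurable_blockDensity (hch : IsAWGNChannel P X N Y) (n : ℕ) :
    Measurable (blockDensity P X n) := by
  have := Measure.isProbabilityMeasure_map (hch.measurable_block_input n).aemeasurable (μ := P)
  exact measurable_outputDensity measurable_stdGaussianDensity

lemma blockDensity_pos (hch : IsAWGNChannel P X N Y) (n : ℕ) (y : Fin n → ℝ) :
    0 < blockDensity P X n y := by
  have := Measure.isProbabilityMeasure_map (hch.measurable_block_input n).aemeasurable (μ := P)
  exact outputDensity_pos measurable_stdGaussianDensity stdGaussianDensity_pos
    stdGaussianDensity_le_one y

lemma map_block_output (hch : IsAWGNChannel P X N Y) (n : ℕ) :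
    P.map (block Y n) = volume.withDensity fun y => ENNReal.ofReal (blockDensity P X n y) :=
  map_output measurable_stdGaussianDensity stdGaussianDensity_pos stdGaussianDensity_le_one
    (hch.measurable_block_input n) (hch.measurable_block_noise n) (hch.indepFun_block n)
    (hch.map_block_noise n) (hch.block_output_eq n)

lemma integrable_log_blockDensity (hch : IsAWGNChannel P X N Y) (hX : ∀ i, MemLp (X i) 2 P)
    (n : ℕ) : Integrable (fun y => Real.log (blockDensity P X n y)) (P.map (block Y n)) := by
  have := Measure.isProbabilityMeasure_map (hch.measurable_block_input n).aemeasurable (μ := P)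
  have := Measure.isProbabilityMeasure_map (hch.measurable_block_output n).aemeasurable (μ := P)
  refine integrable_log_outputDensity measurable_stdGaussianDensity stdGaussianDensity_pos
    stdGaussianDensity_le_one ?_
  -- The log-density is a sum of quadratics in `y i - x i`, so second moments suffice.
  simp only [log_stdGaussianDensity]
  refine integrable_finsetSum _ fun i _ => integrable_log_gaussianPDFReal_comp ?_
  have h1 : MemLp (fun y : Fin n → ℝ => y i) 2 (P.map (block Y n)) :=
    (memLp_map_measure_iff (measurable_pi_apply i).aestronglyMeasurable
      (hch.measurable_block_output n).aemeasurable).2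
      (hch.memLp_output (hX i))
  have h2 : MemLp (fun x : Fin n → ℝ => x i) 2 (P.map (block X n)) :=
    (memLp_map_measure_iff (measurable_pi_apply i).aestronglyMeasurable
      (hch.measurable_block_input n).aemeasurable).2 (hX i)
  exact (h1.comp_fst _).sub (h2.comp_snd _)

lemma hasFiniteDiffEntropy_block (hch : IsAWGNChannel P X N Y) (hX : ∀ i, MemLp (X i) 2 P)
    (n : ℕ) : HasFiniteDiffEntropy (P.map (block Y n)) :=
  hasFiniteDiffEntropy_of_density (hch.measurable_blockDensity n) (hch.blockDensity_pos n)
    (hch.map_block_output n) (hch.integrable_log_blockDensity hX n)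

lemma diffEntropy_block (hch : IsAWGNChannel P X N Y) (n : ℕ) :
    diffEntropy (P.map (block Y n)) = -∫ ω, Real.log (blockDensity P X n (block Y n ω)) ∂P := by
  rw [diffEntropy_eq_of_density (hch.measurable_blockDensity n) (hch.blockDensity_pos n)
    (hch.map_block_output n), integral_map (hch.measurable_block_output n).aemeasurable
    (hch.measurable_blockDensity n).log.aestronglyMeasurable]

lemma mutualInfo_block (hch : IsAWGNChannel P X N Y) (hX : ∀ i, MemLp (X i) 2 P) (n : ℕ) :
    mutualInfo P (block X n) (block Y n) ≠ ⊤ ∧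
      (mutualInfo P (block X n) (block Y n)).toReal =
        n * gaussianLogMean + diffEntropy (P.map (block Y n)) := by
  rw [← hch.integral_log_block_noise n]
  exact mutualInfo_additiveNoise measurable_stdGaussianDensity stdGaussianDensity_pos
    stdGaussianDensity_le_one (hch.measurable_block_input n) (hch.measurable_block_noise n)
    (hch.indepFun_block n) (hch.map_block_noise n) (hch.block_output_eq n)
    (hch.integrable_log_block_noise n) (hch.integrable_log_blockDensity hX n)

/-- The general channel results are applied directly on `ℝ`, as `X 0` is not literally the block of
length one. -/
lemma singleLetter (hch : IsAWGNChannel P X N Y) (hX : MemLp (X 0) 2 P) :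
    HasFiniteDiffEntropy (P.map (Y 0)) ∧ mutualInfo P (X 0) (Y 0) ≠ ⊤ ∧
      (mutualInfo P (X 0) (Y 0)).toReal = gaussianLogMean + diffEntropy (P.map (Y 0)) := by
  have hXm := hch.measurable_input 0
  have hYm := hch.measurable_output 0
  have := Measure.isProbabilityMeasure_map hXm.aemeasurable (μ := P)
  have := Measure.isProbabilityMeasure_map hYm.aemeasurable (μ := P)
  have hφ := measurable_gaussianPDFReal 0 1
  have hlaw := map_output hφ gaussianPDFReal_zero_one_pos gaussianPDFReal_zero_one_le_one
    hXm (hch.measurable_noise 0) hch.indepFun_zero hch.map_noise_zero (hch.output_eq 0)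
  have hint := integrable_log_outputDensity (ν := P.map (Y 0)) (ρ := P.map (X 0)) hφ
    gaussianPDFReal_zero_one_pos gaussianPDFReal_zero_one_le_one <| by
      refine integrable_log_gaussianPDFReal_comp (MemLp.sub ?_ ?_)
      · exact ((memLp_map_measure_iff (g := id) (by fun_prop) hYm.aemeasurable).2
          (hch.memLp_output hX)).comp_fst _
      · exact ((memLp_map_measure_iff (g := id) (by fun_prop) hXm.aemeasurable).2 hX).comp_snd _
  refine ⟨hasFiniteDiffEntropy_of_density (measurable_outputDensity hφ)
    (outputDensity_pos hφ gaussianPDFReal_zero_one_pos gaussianPDFReal_zero_one_le_one) hlaw hint,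
    ?_⟩
  rw [← hch.integral_log_noise 0]
  exact mutualInfo_additiveNoise hφ gaussianPDFReal_zero_one_pos gaussianPDFReal_zero_one_le_one
    hXm (hch.measurable_noise 0) hch.indepFun_zero hch.map_noise_zero (hch.output_eq 0)
    (hch.integrable_log_noise 0) hint

/-- Gibbs' inequality compares the density of the long block with the product `g` of the densities
of its two parts; `log g` splits into a sum. -/
lemma diffEntropy_block_add_le (hch : IsAWGNChannel P X N Y) (hX : ∀ i, MemLp (X i) 2 P)
    (n m : ℕ) :
    diffEntropy (P.map (block Y (n + m))) ≤
      diffEntropy (P.map (block Y n)) +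
        diffEntropy (P.map (block (fun i => Y (n + i)) m)) := by
  have hch' := hch.shift n
  have := Measure.isProbabilityMeasure_map (hch.measurable_block_output (n + m)).aemeasurable
    (μ := P)
  have := Measure.isProbabilityMeasure_map (hch.measurable_block_output n).aemeasurable (μ := P)
  have := Measure.isProbabilityMeasure_map (hch'.measurable_block_output m).aemeasurable (μ := P)
  set p := blockDensity P X n
  set q := blockDensity P (fun i => X (n + i)) m
  have hp : Measurable p := hch.measurable_blockDensity n
  have hq : Measurable q := hch'.measurable_blockDensity m
  have hp0 : ∀ y, 0 < p y := hch.blockDensity_pos n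
  have hq0 : ∀ y, 0 < q y := hch'.blockDensity_pos m
  have hp1 : ∫⁻ y, ENNReal.ofReal (p y) = 1 := by
    rw [← setLIntegral_univ, ← withDensity_apply _ MeasurableSet.univ, ← hch.map_block_output n,
      measure_univ]
  have hq1 : ∫⁻ y, ENNReal.ofReal (q y) = 1 := by
    rw [← setLIntegral_univ, ← withDensity_apply _ MeasurableSet.univ, ← hch'.map_block_output m,
      measure_univ]
  set g : (Fin (n + m) → ℝ) → ℝ := fun y =>
    p (fun i => y (Fin.castAdd m i)) * q (fun j => y (Fin.natAdd n j)) with hg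
  have hgm : Measurable g := by fun_prop
  have hg0 : ∀ y, 0 < g y := fun y => mul_pos (hp0 _) (hq0 _)
  have hg1 : ∫⁻ y, ENNReal.ofReal (g y) ≤ 1 := by
    simp only [hg, ENNReal.ofReal_mul (hp0 _).le]
    rw [lintegral_split_mul (f := fun y => ENNReal.ofReal (p y))
      (g := fun y => ENNReal.ofReal (q y)) (by fun_prop) (by fun_prop), hp1, hq1, one_mul]
  have hlog : (fun ω => Real.log (g (block Y (n + m) ω))) = fun ω =>
      Real.log (p (block Y n ω)) + Real.log (q (block (fun i => Y (n + i)) m ω)) := by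
    ext ω
    exact Real.log_mul (hp0 _).ne' (hq0 _).ne'
  have hpi : Integrable (fun ω => Real.log (p (block Y n ω))) P :=
    (hch.integrable_log_blockDensity hX n).comp_measurable (hch.measurable_block_output n)
  have hqi : Integrable (fun ω => Real.log (q (block (fun i => Y (n + i)) m ω))) P :=
    (hch'.integrable_log_blockDensity (fun i => hX _) m).comp_measurable
      (hch'.measurable_block_output m)
  have hYm := (hch.measurable_block_output (n + m)).aemeasurable (μ := P)
  have hgi : Integrable (fun y => Real.log (g y)) (P.map (block Y (n + m))) := by
    rw [integrable_map_measure hgm.log.aestronglyMeasurable hYm]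
    exact (hpi.add hqi).congr (ae_of_all _ fun ω => (congrFun hlog ω).symm)
  have key := integral_log_density_le (hch.measurable_blockDensity (n + m))
    (hch.blockDensity_pos (n + m)) (hch.map_block_output (n + m))
    (hch.integrable_log_blockDensity hX (n + m)) hgm hg0 hg1 hgi
  rw [integral_map hYm hgm.log.aestronglyMeasurable, hlog, integral_add hpi hqi,
    integral_map hYm (hch.measurable_blockDensity (n + m)).log.aestronglyMeasurable] at key
  rw [hch.diffEntropy_block, hch.diffEntropy_block, hch'.diffEntropy_block]
  linarith

/-- The output density depends only on the law of the input block; this transfers stationarity from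
input to output. -/
lemma map_block_output_congr (hch : IsAWGNChannel P X N Y) {X' N' Y' : ℕ → Ω → ℝ}
    (hch' : IsAWGNChannel P X' N' Y') {n : ℕ} (h : P.map (block X n) = P.map (block X' n)) :
    P.map (block Y n) = P.map (block Y' n) := by
  rw [hch.map_block_output, hch'.map_block_output, blockDensity, blockDensity, h]

/-- For a stationary input with finite power, the entropy rate of the output exists. -/
theorem tendsto_diffEntropyRate (hch : IsAWGNChannel P X N Y) (hX : ∀ i, MemLp (X i) 2 P)
    (hstat : ∀ s n : ℕ, P.map (block X n) = P.map (block (fun i => X (s + i)) n)) :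
    Tendsto (fun n : ℕ => diffEntropy (P.map (block Y n)) / (n : ℝ)) atTop
      (nhds (diffEntropyRate P Y)) := by
  have hsub : Subadditive fun n => diffEntropy (P.map (block Y n)) := fun n m => by
    beta_reduce
    rw [hch.map_block_output_congr (hch.shift n) (hstat n m)]
    exact hch.diffEntropy_block_add_le hX n m
  have hbdd : BddBelow (Set.range fun n : ℕ => diffEntropy (P.map (block Y n)) / (n : ℝ)) := by
    -- Nonnegative mutual information gives the bound `-gaussianLogMean` for `n > 0`; the absolute
    -- value also covers `n = 0`, where the quotient is `0`.
    refine ⟨-|gaussianLogMean|, ?_⟩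
    rintro _ ⟨n, rfl⟩
    have h1 := (hch.mutualInfo_block hX n).2 ▸ ENNReal.toReal_nonneg
    have h2 := le_abs_self gaussianLogMean
    rcases Nat.eq_zero_or_pos n with rfl | hn
    · simp
    · have : (0 : ℝ) < n := Nat.cast_pos.2 hn
      rw [le_div_iff₀ this]
      nlinarith
  exact tendsto_nhds_limUnder ⟨_, hsub.tendsto_lim hbdd⟩

end IsAWGNChannel

lemma IsStationary.map_block_shift {μ : Measure (ℕ → ℝ)} (hμ : IsStationary μ)
    (hX : P.map (fun ω i => X i ω) = μ) (hXm : ∀ i, Measurable (X i)) (s n : ℕ) :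
    P.map (block X n) = P.map (block (fun i => X (s + i)) n) := by
  have h := hμ 0 s n
  rw [← hX, Measure.map_map (by fun_prop) (by fun_prop),
    Measure.map_map (by fun_prop) (by fun_prop)] at h
  simp only [zero_add] at h
  exact h

/-- Stationarity for blocks of length one makes every `X i` distributed as `X 0`. -/
lemma IsStationary.memLp {μ : Measure (ℕ → ℝ)} (hμ : IsStationary μ)
    (hX : P.map (fun ω i => X i ω) = μ) (hXm : ∀ i, Measurable (X i)) (h0 : MemLp (X 0) 2 P)
    (i : ℕ) : MemLp (X i) 2 P := by
  have h : IdentDistrib (block X 1) (block (fun j => X (i + j)) 1) P P :=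
    ⟨(measurable_block hXm 1).aemeasurable,
      (measurable_block (fun j => hXm (i + j)) 1).aemeasurable,
      hμ.map_block_shift hX hXm i 1⟩
  exact (h.comp (measurable_pi_apply (0 : Fin 1))).memLp_iff.1 h0

end Channel

end AWGN

theorem proposition2 {Ω : Type*} [MeasurableSpace Ω] (P : MeasureTheory.Measure Ω)
    [MeasureTheory.IsProbabilityMeasure P] (γ q c : ℝ) (μ : MeasureTheory.Measure (ℕ → ℝ))
    (hμ : μ ∈ AWGN.inputLaws γ q c) (X N Y : ℕ → Ω → ℝ)
    (hch : AWGN.IsAWGNChannel P X N Y) (hX : P.map (fun ω i => X i ω) = μ) :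
    -- all the quantities involved are well defined and finite
    (∀ n : ℕ, AWGN.mutualInfo P (AWGN.block X n) (AWGN.block Y n) ≠ ⊤) ∧
    AWGN.mutualInfo P (X 0) (Y 0) ≠ ⊤ ∧
    (∀ n : ℕ, AWGN.HasFiniteDiffEntropy (P.map (AWGN.block Y n))) ∧
    AWGN.HasFiniteDiffEntropy (P.map (Y 0)) ∧
    -- the differential entropy rate of the output process exists as a limit
    Filter.Tendsto (fun n : ℕ => AWGN.diffEntropy (P.map (AWGN.block Y n)) / (n : ℝ))
      Filter.atTop (nhds (AWGN.diffEntropyRate P Y)) ∧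
    -- the limit of the mutual information per symbol
    Filter.Tendsto
      (fun n : ℕ => (AWGN.mutualInfo P (AWGN.block X n) (AWGN.block Y n)).toReal / (n : ℝ))
      Filter.atTop
      (nhds ((AWGN.mutualInfo P (X 0) (Y 0)).toReal - AWGN.diffEntropy (P.map (Y 0))
        + AWGN.diffEntropyRate P Y)) := by
  obtain ⟨-, hstat, ⟨hsq, -⟩, -⟩ := hμ
  have hXm := hch.measurable_input
  have h0 : MeasureTheory.MemLp (X 0) 2 P := by
    rw [MeasureTheory.memLp_two_iff_integrable_sq (hXm 0).aestronglyMeasurable]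
    rw [← hX] at hsq
    exact hsq.comp_measurable (by fun_prop)
  have hmem := hstat.memLp hX hXm h0
  obtain ⟨hh, hI, hIeq⟩ := hch.singleLetter h0
  have hrate := hch.tendsto_diffEntropyRate hmem (hstat.map_block_shift hX hXm)
  refine ⟨fun n => (hch.mutualInfo_block hmem n).1, hI, hch.hasFiniteDiffEntropy_block hmem, hh,
    hrate, ?_⟩
  -- The single-letter terms collapse to `gaussianLogMean`, the per-symbol gap between mutual
  -- information and output entropy.
  rw [hIeq, add_sub_cancel_right]
  refine (hrate.const_add AWGN.gaussianLogMean).congr' ?_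
  filter_upwards [Filter.eventually_ne_atTop 0] with n hn
  have : (n : ℝ) ≠ 0 := Nat.cast_ne_zero.2 hn
  rw [(hch.mutualInfo_block hmem n).2, add_div, mul_div_cancel_left₀ _ this]
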